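/- All spaces are $T_0$. A paratopological group is a group with a topology for which multiplication $G\times G\to G$ is continuous. For a space $X$, let $AP(X)$ be the Markov free Abelian paratopological group on $X$, i.e. an Abelian paratopological group that contains $X$ as a subspace, is algebraically generated by $X$, and is such that every continuous map from $X$ to an Abelian paratopological group $H$ extends to a continuous homomorphism $AP(X)\to H$. **Theorem.** Let $X$ be a functionally Hausdorff space, i.e. for any two distinct points $x,y\in X$ there is a continuous function $f:X\to\mathbb{R}$ with $f(x)\neq f(y)$. If $AP(X)$ is of almost subcountable type, i.e. it contains a non-empty compact set that is a $G_\delta$-set in $AP(X)$, then $X$ has countable pseudocharacter, i.e. for every $x\in X$ the set $\{x\}$ is a $G_\delta$-set in $X$. -/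

import Mathlib

universe u

/-- Distinct points are separated by a continuous real-valued function. -/
def FunctionallyHausdorff (X : Type*) [TopologicalSpace X] : Prop :=
  ∀ x y : X, x ≠ y → ∃ f : X → ℝ, Continuous f ∧ f x ≠ f y

/-- The space contains a non-empty compact set that is a `G_δ`-set. -/
def AlmostSubcountableType (X : Type*) [TopologicalSpace X] : Prop :=
  ∃ K : Set X, K.Nonempty ∧ IsCompact K ∧ IsGδ K

/-- Every one-point subset is the intersection of countably many open sets. -/
def CountablePseudocharacter (X : Type*) [TopologicalSpace X] : Prop :=
  ∀ x : X, IsGδ ({x} : Set X)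

/-- `G` together with `i : X → G` is the Markov free Abelian paratopological group `AP(X)`:
`G` is an Abelian paratopological group (written additively, with continuous addition;
negation need not be continuous), `i` identifies `X` with a subspace of `G` that generates `G`,
and every continuous map from `X` to an Abelian paratopological group extends to a continuous
homomorphism on `G`. As usual, paratopological groups are `T₀`. -/
structure IsFreeAbelianParatopologicalGroup {X G : Type u} [TopologicalSpace X]
    [AddCommGroup G] [TopologicalSpace G] (i : X → G) : Prop where
  t0Space : T0Space G
  continuousAdd : ContinuousAdd G
  isEmbedding : Topology.IsEmbedding i
  closure_range : AddSubgroup.closure (Set.range i) = ⊤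
  exists_extension : ∀ (H : Type u) [AddCommGroup H] [TopologicalSpace H] [T0Space H]
    [ContinuousAdd H] (f : X → H), Continuous f →
      ∃ F : G →+ H, Continuous F ∧ ∀ x, F (i x) = f x

/-!
Homomorphisms of `AP(X)` into `ℝ` separate points when `X` is functionally Hausdorff: given a
non-trivial combination of points of `X`, some continuous `f : X → ℝ` vanishes at all of its
points but one, and the extension of `f` does not kill the combination.

In any Abelian paratopological group, a `G_δ`-set containing `0` contains the intersection `N` of
a sequence of open sets that is closed under addition. If the `G_δ`-set is a translate of a
compact set, then a continuous homomorphism to `ℝ` is bounded on `N`, and thus zero on `N`,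
because `N` contains all multiples of its elements. When these homomorphisms separate points,
`N = {0}`, so that all points of the group, and with them all points of `X`, are `G_δ`.
-/

open Set

theorem FunctionallyHausdorff.exists_continuous_eq_one_eq_zero {X : Type*} [TopologicalSpace X]
    (hX : FunctionallyHausdorff X) (x : X) (s : Finset X) (hx : x ∉ s) :
    ∃ f : X → ℝ, Continuous f ∧ f x = 1 ∧ ∀ y ∈ s, f y = 0 := by
  have h : ∀ y : X, ∃ f : X → ℝ, Continuous f ∧ f x = 1 ∧ (y ≠ x → f y = 0) := by
    intro y
    by_cases hy : y = x
    · exact ⟨fun _ => 1, continuous_const, rfl, fun h => absurd hy h⟩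
    · obtain ⟨g, hg, hne⟩ := hX x y (Ne.symm hy)
      have hne' : g x - g y ≠ 0 := sub_ne_zero.mpr hne
      exact ⟨fun z => (g z - g y) / (g x - g y), by fun_prop, div_self hne', by simp⟩
  choose f hf h1 h0 using h
  refine ⟨fun z => ∏ y ∈ s, f y z, continuous_finsetProd s fun y _ => hf y, ?_, ?_⟩
  · exact Finset.prod_eq_one fun y _ => h1 y
  · intro y hy
    exact Finset.prod_eq_zero hy (h0 y fun h => hx (h ▸ hy))

theorem IsFreeAbelianParatopologicalGroup.exists_continuous_extension_real {X G : Type u}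
    [TopologicalSpace X] [AddCommGroup G] [TopologicalSpace G] {i : X → G}
    (hG : IsFreeAbelianParatopologicalGroup i) {f : X → ℝ} (hf : Continuous f) :
    ∃ F : G →+ ℝ, Continuous F ∧ ∀ x, F (i x) = f x := by
  -- The universal property concerns groups in the universe of `X`, hence the lift of `ℝ`.
  obtain ⟨F, hF, hFi⟩ := hG.exists_extension (ULift.{u} ℝ) (fun x => ULift.up (f x))
    (continuous_uliftUp.comp hf)
  exact ⟨(AddEquiv.ulift (α := ℝ)).toAddMonoidHom.comp F, continuous_uliftDown.comp hF,
    fun x => congrArg ULift.down (hFi x)⟩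

theorem IsFreeAbelianParatopologicalGroup.exists_continuous_hom_ne_zero {X G : Type u}
    [TopologicalSpace X] [AddCommGroup G] [TopologicalSpace G] {i : X → G}
    (hG : IsFreeAbelianParatopologicalGroup i) (hX : FunctionallyHausdorff X) {g : G}
    (hg : g ≠ 0) : ∃ F : G →+ ℝ, Continuous F ∧ F g ≠ 0 := by
  classical
  have hmem : g ∈ Submodule.span ℤ (range i) := by
    rw [← Submodule.mem_toAddSubgroup, Submodule.span_int_eq_addSubgroupClosure,
      hG.closure_range]
    trivial
  obtain ⟨c, rfl⟩ := Finsupp.mem_span_range_iff_exists_finsupp.mp hmem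
  obtain ⟨x, hx⟩ : ∃ x, c x ≠ 0 := by
    by_contra! h
    exact hg (by simp [Finsupp.sum, h])
  obtain ⟨f, hf, hfx, hf0⟩ := hX.exists_continuous_eq_one_eq_zero x (c.support.erase x) (by simp)
  obtain ⟨F, hF, hFi⟩ := hG.exists_continuous_extension_real hf
  refine ⟨F, hF, ?_⟩
  have hsum : F (c.sum fun y n => n • i y) = c x := by
    rw [Finsupp.sum, map_sum, Finset.sum_eq_single x]
    · simp [hFi, hfx]
    · intro y hy hyx
      simp [hFi, hf0 y (Finset.mem_erase.mpr ⟨hyx, hy⟩)]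
    · intro h
      simp [Finsupp.notMem_support_iff.mp h]
  rw [hsum]
  exact_mod_cast hx

theorem IsGδ.exists_addSubmonoid_subset {G : Type*} [AddMonoid G] [TopologicalSpace G]
    [ContinuousAdd G] {S : Set G} (hS : IsGδ S) (h0 : (0 : G) ∈ S) :
    ∃ N : AddSubmonoid G, IsGδ (N : Set G) ∧ (N : Set G) ⊆ S := by
  obtain ⟨U, hU, rfl⟩ := isGδ_iff_eq_iInter_nat.mp hS
  have half : ∀ W : {W : Set G // IsOpen W ∧ (0 : G) ∈ W}, ∃ V : {V : Set G // IsOpen V ∧ 0 ∈ V},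
      ∀ a ∈ V.1, ∀ b ∈ V.1, a + b ∈ W.1 := by
    rintro ⟨W, hW, hW0⟩
    obtain ⟨V, hV, hV0, hVW⟩ := exists_open_nhds_zero_half (hW.mem_nhds hW0)
    exact ⟨⟨V, hV, hV0⟩, hVW⟩
  choose half hhalf using half
  let V : ℕ → {W : Set G // IsOpen W ∧ (0 : G) ∈ W} := fun n =>
    Nat.rec ⟨univ, isOpen_univ, mem_univ 0⟩ (fun n W => ⟨(half W).1 ∩ U n,
      (half W).2.1.inter (hU n), (half W).2.2, mem_iInter.mp h0 n⟩) n
  have hV : ∀ n, (V (n + 1)).1 = (half (V n)).1 ∩ U n := fun n => rfl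
  refine ⟨⟨⟨⋂ n, (V n).1, ?_⟩, mem_iInter.mpr fun n => (V n).2.2⟩,
    IsGδ.iInter_of_isOpen fun n => (V n).2.1, ?_⟩
  · intro a b ha hb
    refine mem_iInter.mpr fun n => hhalf (V n) a ?_ b ?_
    · exact ((hV n).subset (mem_iInter.mp ha (n + 1))).1
    · exact ((hV n).subset (mem_iInter.mp hb (n + 1))).1
  · exact fun a ha => mem_iInter.mpr fun n => ((hV n).subset (mem_iInter.mp ha (n + 1))).2

/-- A real-valued continuous homomorphism vanishes on a submonoid `N` some translate of which lies
in a compact set, since it is bounded there along all multiples of an element of `N`. -/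
theorem AlmostSubcountableType.isGδ_singleton {G : Type*} [AddCommGroup G] [TopologicalSpace G]
    [ContinuousAdd G] (hK : AlmostSubcountableType G)
    (hsep : ∀ g : G, g ≠ 0 → ∃ F : G →+ ℝ, Continuous F ∧ F g ≠ 0) (g : G) :
    IsGδ ({g} : Set G) := by
  obtain ⟨K, ⟨k, hk⟩, hKc, hKδ⟩ := hK
  obtain ⟨N, hN, hNK⟩ := (hKδ.preimage (continuous_const_add k)).exists_addSubmonoid_subset
    (by simpa using hk)
  have hN0 : (N : Set G) = {0} := by
    refine Subset.antisymm (fun a ha => ?_) (singleton_subset_iff.mpr N.zero_mem)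
    by_contra hne
    obtain ⟨F, hF, hFa⟩ := hsep a hne
    obtain ⟨C, hC⟩ := hKc.exists_bound_of_continuousOn hF.continuousOn
    obtain ⟨m, hm⟩ := exists_nat_gt ((C + |F k|) / |F a|)
    rw [div_lt_iff₀ (abs_pos.mpr hFa)] at hm
    have hb : |F k + m * F a| ≤ C := by
      simpa using hC _ (hNK (N.nsmul_mem ha m))
    have ht : |(m : ℝ) * F a| ≤ |F k + m * F a| + |F k| := by
      simpa using abs_sub (F k + m * F a) (F k)
    rw [abs_mul, Nat.abs_cast] at ht
    linarith
  have hpre : ({g} : Set G) = (fun a => -g + a) ⁻¹' (N : Set G) := by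
    ext a
    simp [hN0, eq_comm]
  rw [hpre]
  exact hN.preimage (continuous_const_add (-g))

theorem theorem4p4 {X G : Type u} [TopologicalSpace X] [AddCommGroup G] [TopologicalSpace G]
    (i : X → G) (hX : FunctionallyHausdorff X) (hG : IsFreeAbelianParatopologicalGroup i)
    (hK : AlmostSubcountableType G) : CountablePseudocharacter X := by
  intro x
  have := hG.continuousAdd
  have hix := hK.isGδ_singleton (fun _ hg => hG.exists_continuous_hom_ne_zero hX hg) (i x)
  have hpre : ({x} : Set X) = i ⁻¹' {i x} := by
    rw [← image_singleton, hG.isEmbedding.injective.preimage_image]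
  rw [hpre]
  exact hix.preimage hG.isEmbedding.continuous
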